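/- **Model.** A test gateway sits at the origin of the plane. Let $\Delta x,\Delta y,R,P>0$, $\eta>2$, noise power $\sigma^2\ge 0$, $\mathcal N_G\in\mathbb N$ with $\mathcal N_G\ge 1$, and let $G(\theta)=1+b\cos(n\theta)$ with $0\le b\le 1$ and $n\in\mathbb N$ be the gateway's antenna gain; all devices are omni-directional (gain $1$) and transmit with constant power $P$. The intended device is at a point $v_o\neq 0$ at distance $r_o=\|v_o\|$ and the gateway's antenna points at it. In the 2-D PPP approximation the device locations form a homogeneous Poisson point process $\Psi=\{v_i\}$ on $\mathbb R^2$ of intensity $\frac{1}{\Delta x\,\Delta y\,\mathcal N_G}$, and those with $\|v_i\|\ge\frac{\sqrt3R}{2}$ interfere. The fading gains $h_o,h_1,h_2,\dots$ are i.i.d. exponential with mean $1$ and independent of $\Psi$. With $\theta_i$ the angle between $v_i$ and $v_o$, and $g_o$ the receive gain of the intended link, put $$\mathrm{SINR}=\frac{P\,h_o\,g_o\,r_o^{-\eta}}{\sigma^2+\sum_{i:\ \|v_i\|\ge \sqrt3R/2}P\,h_i\,G(\theta_i)\,\|v_i\|^{-\eta}},\qquad p_m=\mathbb P\{\mathrm{SINR}>\Xi_m\},\qquad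 \Xi_m=2^{\frac{L}{m\zeta WT_s}}-1,$$ where $L,W,T_s>0$, $0<\zeta\le1$ and $m\ge 1$ is an integer. Below, ${}_2F_1(a,b;c;\cdot)$ is the Gauss hypergeometric function, analytically continued to $(-\infty,1)$. **Corollary 3.** If the intended link has the aligned gain $g_o=2$ (the value of $G(0)$ for $b=1$), then $$p_m=\exp\left\{-\frac{\Xi_m r_o^{\eta}\sigma^2}{2P}-\int_0^{2\pi}\frac{\Xi_m r_o^{\eta}\,G(\theta)\left(\frac{\sqrt3R}{2}\right)^{2-\eta}}{2\,\Delta x\,\Delta y\,\mathcal N_G(\eta-2)}\;{}_2F_1\!\left(1,1-\frac2\eta;2-\frac2\eta;\frac{-\Xi_m r_o^{\eta}G(\theta)}{2\left(\frac{\sqrt3R}{2}\right)^{\eta}}\right)d\theta\right\}.$$ If instead $g_o=G(0)=1+b$, the same formula holds with each of the three factors $2$ in the denominators $2P$, $2\,\Delta x\,\Delta y\,\mathcal N_G(\eta-2)$ and $2\left(\frac{\sqrt3R}{2}\right)^{\eta}$ replaced by $1+b$. -/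

import Mathlib

open MeasureTheory ProbabilityTheory Set
open scoped ENNReal NNReal

noncomputable section

namespace IoTNetwork

/-! ### The Gauss hypergeometric function on the real half-line `(-∞, 1)` -/

/-- `F` is the analytic continuation to `(-∞, 1)` of the Gauss hypergeometric series with real
parameters `a`, `b`, `c`.  (Mathlib's `ordinaryHypergeometric` is only the sum of the power series,
with a junk value for arguments outside its disc of convergence.) -/
def IsGaussHypergeometric (a b c : ℝ) (F : ℝ → ℝ) : Prop :=
  AnalyticOnNhd ℝ F (Iio 1) ∧ ∀ x : ℝ, |x| < 1 → F x = ordinaryHypergeometric a b c x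

/-- The continuation is unique on `(-∞, 1)`. -/
theorem IsGaussHypergeometric.eqOn {a b c : ℝ} {F F' : ℝ → ℝ}
    (hF : IsGaussHypergeometric a b c F) (hF' : IsGaussHypergeometric a b c F') :
    EqOn F F' (Iio 1) := by
  refine hF.1.eqOn_of_preconnected_of_eventuallyEq hF'.1 isPreconnected_Iio
    (z₀ := 0) (by simp) ?_
  filter_upwards [Ioo_mem_nhds (show (-1 : ℝ) < 0 by norm_num) (show (0 : ℝ) < 1 by norm_num)]
    with x hx
  rw [hF.2 x (abs_lt.2 hx), hF'.2 x (abs_lt.2 hx)]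

open Classical in
/-- The Gauss hypergeometric function `₂F₁(a, b; c; x)` for real `x < 1`. -/
def gauss2F1 (a b c x : ℝ) : ℝ :=
  if h : ∃ F : ℝ → ℝ, IsGaussHypergeometric a b c F then h.choose x else 0

theorem gaussCoefficient_eq {b : ℝ} (hb : 0 < b) (n : ℕ) :
    ((n.factorial : ℝ)⁻¹ * (ascPochhammer ℝ n).eval 1 * (ascPochhammer ℝ n).eval b *
      ((ascPochhammer ℝ n).eval (b + 1))⁻¹) = b / (b + n) := by
  have h1 : (ascPochhammer ℝ n).eval (1 : ℝ) = n.factorial := by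
    simp
  have h2 : (ascPochhammer ℝ n).eval b * (b + n) = b * (ascPochhammer ℝ n).eval (b + 1) := by
    rw [← ascPochhammer_succ_eval, ascPochhammer_succ_left]
    simp [Polynomial.eval_comp]
  have h3 : 0 < (ascPochhammer ℝ n).eval (b + 1) := ascPochhammer_pos n _ (by linarith)
  have h4 : (n.factorial : ℝ) ≠ 0 := by positivity
  have h5 : 0 < b + n := by positivity
  rw [h1]
  field_simp
  linarith

/-- The continuation exists for the parameters `1`, `b`, `b + 1` with `b > 0`; it is given by Euler's
integral. -/
theorem exists_isGaussHypergeometric {b : ℝ} (hb : 0 < b) :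
    ∃ F : ℝ → ℝ, IsGaussHypergeometric 1 b (b + 1) F := by
  let g : ℂ → ℂ := fun z => ∫ t in Ioc (0 : ℝ) 1, ((t ^ (b - 1) : ℝ) : ℂ) / (1 - z * t)
  have hint : IntegrableOn (fun t : ℝ => t ^ (b - 1)) (Ioc 0 1) :=
    (intervalIntegrable_iff_integrableOn_Ioc_of_le zero_le_one).1
      (intervalIntegral.intervalIntegrable_rpow' (by linarith))
  have hmeas : ∀ z : ℂ, AEStronglyMeasurable
      (fun t : ℝ => ((t ^ (b - 1) : ℝ) : ℂ) / (1 - z * t)) (volume.restrict (Ioc 0 1)) := by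
    intro z
    exact Measurable.aestronglyMeasurable (by fun_prop)
  have hden : ∀ {δ : ℝ} {z : ℂ} {t : ℝ}, δ ≤ 1 → δ ≤ 1 - z.re → t ∈ Ioc (0 : ℝ) 1 →
      δ ≤ ‖1 - z * t‖ := by
    intro δ z t h1 h2 ht
    refine le_trans ?_ (Complex.re_le_norm _)
    simp
    nlinarith [ht.1, ht.2]
  have hdiff : DifferentiableOn ℂ g {z | z.re < 1} := by
    intro z hz
    have hz : z.re < 1 := hz
    obtain ⟨δ, hδ, hδ1, hδz⟩ : ∃ δ : ℝ, 0 < δ ∧ δ ≤ 1 ∧ δ + δ ≤ 1 - z.re :=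
      ⟨min 1 ((1 - z.re) / 2), by simp; linarith, min_le_left _ _,
        by linarith [min_le_right 1 ((1 - z.re) / 2)]⟩
    have hball : ∀ w ∈ Metric.ball z δ, δ ≤ 1 - w.re := by
      intro w hw
      have := (Complex.abs_re_le_norm (w - z)).trans_lt (mem_ball_iff_norm.1 hw)
      rw [Complex.sub_re, abs_lt] at this
      linarith [this.2]
    have := (hasDerivAt_integral_of_dominated_loc_of_deriv_le (𝕜 := ℂ)
      (μ := volume.restrict (Ioc (0:ℝ) 1))
      (F := fun z t => ((t ^ (b - 1) : ℝ) : ℂ) / (1 - z * t))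
      (F' := fun z t => ((t ^ (b - 1) : ℝ) : ℂ) * t / (1 - z * t) ^ 2)
      (x₀ := z) (bound := fun t => t ^ (b - 1) / δ ^ 2) (Metric.ball_mem_nhds z hδ)
      (Filter.Eventually.of_forall hmeas) ?_ ?_ ?_ (hint.div_const _) ?_).2
    · exact this.differentiableAt.differentiableWithinAt
    · refine Integrable.mono' (hint.div_const δ) (hmeas z) ?_
      filter_upwards [ae_restrict_mem measurableSet_Ioc] with t ht
      rw [norm_div, Complex.norm_real, Real.norm_of_nonneg (Real.rpow_nonneg ht.1.le _)]
      exact div_le_div_of_nonneg_left (Real.rpow_nonneg ht.1.le _) hδ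
        (hden hδ1 (by linarith) ht)
    · exact Measurable.aestronglyMeasurable (by fun_prop)
    · filter_upwards [ae_restrict_mem measurableSet_Ioc] with t ht w hw
      rw [norm_div, norm_mul, norm_pow, Complex.norm_real, Complex.norm_real,
        Real.norm_of_nonneg (Real.rpow_nonneg ht.1.le _), Real.norm_of_nonneg ht.1.le]
      have h1 := hden hδ1 (hball w hw) ht
      have h2 := Real.rpow_nonneg ht.1.le (b - 1)
      refine div_le_div₀ h2 ?_ (by positivity) (by gcongr)
      nlinarith [ht.2]
    · filter_upwards [ae_restrict_mem measurableSet_Ioc] with t ht w hw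
      have h1 := hden hδ1 (hball w hw) ht
      have h2 : (1 - w * t) ≠ 0 := norm_pos_iff.1 (hδ.trans_le h1)
      have h3 : HasDerivAt (fun w : ℂ => 1 - w * t) (-(1 * (t : ℂ))) w :=
        ((hasDerivAt_id w).mul_const _).const_sub 1
      refine ((hasDerivAt_const w ((t ^ (b - 1) : ℝ) : ℂ)).div h3 h2).congr_deriv ?_
      ring
  have hopen : IsOpen {z : ℂ | z.re < 1} := isOpen_lt Complex.continuous_re continuous_const
  have han := (hdiff.analyticOnNhd hopen)
  have hreal : ∀ x : ℝ, (b * (g x).re) =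
      b * ∫ t in Ioc (0:ℝ) 1, t ^ (b - 1) / (1 - x * t) := by
    intro x
    have : g x = ((∫ t in Ioc (0:ℝ) 1, t ^ (b - 1) / (1 - x * t) : ℝ) : ℂ) := by
      rw [← integral_complex_ofReal]
      simp [g]
    rw [this, Complex.ofReal_re]
  refine ⟨fun x => b * (g x).re, ?_, ?_⟩
  · intro x hx
    have h1 : AnalyticAt ℝ g (x : ℂ) := (han x (by simpa using hx)).restrictScalars
    have h2 : AnalyticAt ℝ (fun x : ℝ => g x) x :=
      AnalyticAt.fun_comp (f := fun x : ℝ => (x : ℂ)) h1 (Complex.ofRealCLM.analyticAt x)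
    exact analyticAt_const.mul ((Complex.reCLM.analyticAt _).comp h2)
  · intro x hx
    show b * (g x).re = _
    rw [hreal, ordinaryHypergeometric_eq_tsum]
    simp only [gaussCoefficient_eq hb, smul_eq_mul]
    have hI : ∀ n : ℕ, ∫ t in Ioc (0:ℝ) 1, t ^ (b - 1) * (x * t) ^ n = x ^ n / (b + n) := by
      intro n
      have : ∀ t ∈ Ioc (0:ℝ) 1, t ^ (b - 1) * (x * t) ^ n = x ^ n * t ^ (b - 1 + n) := by
        intro t ht
        rw [Real.rpow_add_natCast ht.1.ne', mul_pow]; ring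
      rw [setIntegral_congr_fun measurableSet_Ioc this, integral_const_mul,
        ← intervalIntegral.integral_of_le zero_le_one,
        integral_rpow (Or.inl (by have : (0:ℝ) ≤ n := by positivity
                                  linarith))]
      have : (0:ℝ) < b + n := by positivity
      have h0 : b - 1 + n + 1 = b + n := by ring
      rw [h0, Real.one_rpow, Real.zero_rpow this.ne']
      ring
    have hs := hasSum_integral_of_dominated_convergence (μ := volume.restrict (Ioc (0:ℝ) 1))
      (F := fun (n : ℕ) t => t ^ (b - 1) * (x * t) ^ n)
      (f := fun t => t ^ (b - 1) / (1 - x * t))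
      (fun n t => t ^ (b - 1) * |x| ^ n) ?_ ?_ ?_ ?_ ?_
    · simp only [hI] at hs
      rw [← hs.tsum_eq, ← tsum_mul_left]
      congr 1
      ext n
      ring
    · intro n
      exact Measurable.aestronglyMeasurable (by fun_prop)
    · intro n
      filter_upwards [ae_restrict_mem measurableSet_Ioc] with t ht
      rw [norm_mul, Real.norm_of_nonneg (Real.rpow_nonneg ht.1.le _), norm_pow, Real.norm_eq_abs,
        abs_mul, abs_of_pos ht.1]
      refine mul_le_mul_of_nonneg_left ?_ (Real.rpow_nonneg ht.1.le (b - 1))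
      exact pow_le_pow_left₀ (mul_nonneg (abs_nonneg x) ht.1.le)
        (mul_le_of_le_one_right (abs_nonneg x) ht.2) n
    · exact Filter.Eventually.of_forall fun t =>
        (summable_geometric_of_lt_one (abs_nonneg x) hx).mul_left _
    · simp only [tsum_mul_left]
      exact hint.mul_const _
    · filter_upwards [ae_restrict_mem measurableSet_Ioc] with t ht
      rw [div_eq_mul_inv]
      refine (hasSum_geometric_of_abs_lt_one ?_).mul_left _
      rw [abs_mul, abs_of_pos ht.1]
      nlinarith [ht.2, abs_nonneg x]

/-- For these parameters `gauss2F1` is the analytic continuation of the Gauss series. -/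
theorem isGaussHypergeometric_gauss2F1 {b : ℝ} (hb : 0 < b) :
    IsGaussHypergeometric 1 b (b + 1) (gauss2F1 1 b (b + 1)) := by
  have h := exists_isGaussHypergeometric hb
  have heq : gauss2F1 1 b (b + 1) = h.choose := by
    funext x
    simp [gauss2F1, h]
  rw [heq]
  exact h.choose_spec

/-! ### Poisson point processes -/

/-- The number of points of the sequence `X` that lie in `A`. -/
def pointCount {Ω E : Type*} (X : ℕ → Ω → E) (A : Set E) (ω : Ω) : ℝ≥0∞ :=
  ∑' i, A.indicator (fun _ => 1) (X i ω)

/-- The random points `X 0, X 1, X 2, …` are an enumeration of a Poisson point process on `E` with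
intensity measure `Λ` of infinite total mass: the number of points in a measurable set `A` of finite
intensity is Poisson distributed with mean `Λ A`, and the numbers of points in disjoint measurable
sets are independent. -/
structure IsPoissonPointProcess {Ω E : Type*} [MeasurableSpace Ω] [MeasurableSpace E]
    (X : ℕ → Ω → E) (Λ : Measure E) (μ : Measure Ω) : Prop where
  measurable : ∀ i, Measurable (X i)
  hasLaw_count : ∀ A : Set E, MeasurableSet A → Λ A ≠ ∞ →
    HasLaw (pointCount X A) ((poissonMeasure (Λ A).toNNReal).map (fun k : ℕ => (k : ℝ≥0∞))) μ
  indep_count : ∀ (k : ℕ) (A : Fin k → Set E), (∀ j, MeasurableSet (A j)) →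
    Pairwise (fun i j => Disjoint (A i) (A j)) →
    iIndepFun (fun j => pointCount X (A j)) μ

/-! ### The network -/

/-- The antenna gain `G(θ) = 1 + b cos(nθ)`. -/
def antennaGain (b : ℝ) (n : ℕ) (θ : ℝ) : ℝ := 1 + b * Real.cos (n * θ)

/-- The decoding threshold `Ξ_m = 2^{L/(m ζ W T_s)} - 1`, i.e. the solution of
`L/(m T_s) = ζ W log₂(1 + Ξ_m)`. -/
def sinrThreshold (L ζ W Ts : ℝ) (m : ℕ) : ℝ := (2 : ℝ) ^ (L / (m * ζ * W * Ts)) - 1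

/-- Intensity `1/(Δx Δy N_G)` (active devices per unit area). -/
def activeDensity (Δx Δy : ℝ) (NG : ℕ) : ℝ := 1 / (Δx * Δy * NG)

/-- The random elements of the 2-D PPP model, the plane being `ℂ` and the test gateway its origin:
`X` enumerates the locations of a homogeneous Poisson point process of intensity `lam` on the plane,
`h₀` is the fading gain of the intended link and `h i` that of the link from `X i` to the test
gateway.  All fading gains are i.i.d. exponential with mean one, and independent of the locations. -/
structure PPPModel {Ω : Type*} [MeasurableSpace Ω] (μ : Measure Ω) (lam : ℝ)
    (X : ℕ → Ω → ℂ) (h₀ : Ω → ℝ) (h : ℕ → Ω → ℝ) : Prop where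
  poisson : IsPoissonPointProcess X (ENNReal.ofReal lam • (volume : Measure ℂ)) μ
  law_h₀ : HasLaw h₀ (expMeasure 1) μ
  law_h : ∀ i, HasLaw (h i) (expMeasure 1) μ
  indep_gains : iIndepFun (fun i : Option ℕ => i.elim h₀ h) μ
  indep_locations : IndepFun (fun ω (i : ℕ) => X i ω) (fun ω (i : Option ℕ) => i.elim h₀ h ω) μ

/-- Aggregate interference at the origin, for constant transmission power `P`, path-loss exponent
`η` and fading gains `h i`, when an interferer at `v` has transmit antenna gain `GT v` and receive
antenna gain `GR v`.  Devices closer than `√3 R / 2` to the test gateway do not interfere. -/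
def interference {Ω : Type*} (P η R : ℝ) (GT GR : ℂ → ℝ) (X : ℕ → Ω → ℂ) (h : ℕ → Ω → ℝ) (ω : Ω) :
    ℝ≥0∞ :=
  ∑' i, {v : ℂ | √3 * R / 2 ≤ ‖v‖}.indicator
    (fun v => ENNReal.ofReal (P * h i ω * GT v * GR v * ‖v‖ ^ (-η))) (X i ω)

/-- The SINR at the origin: `P h₀ g₀ r₀^{-η}` over noise power `σ²` plus interference, where `g₀` is
the product of the antenna gains of the intended link, of length `r₀`. -/
def sinr {Ω : Type*} (P η R σ r₀ g₀ : ℝ) (GT GR : ℂ → ℝ)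
    (X : ℕ → Ω → ℂ) (h₀ : Ω → ℝ) (h : ℕ → Ω → ℝ) (ω : Ω) : ℝ≥0∞ :=
  ENNReal.ofReal (P * h₀ ω * g₀ * r₀ ^ (-η)) /
    (ENNReal.ofReal (σ ^ 2) + interference P η R GT GR X h ω)

/-- The success probability `ℙ(SINR > Ξ)` with a directional gateway and omni-directional devices.
The gateway's antenna points at the intended device, located at `v₀`, so that a signal arriving from
`v` is received with the gain `G(θ)` where `θ` is the angle between `v` and `v₀`; all transmit gains
are one.  `g₀` is the receive gain of the intended link. -/
def successProb {Ω : Type*} [MeasurableSpace Ω] (μ : Measure Ω) (G : ℝ → ℝ)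
    (P η R σ g₀ Ξ : ℝ) (v₀ : ℂ) (X : ℕ → Ω → ℂ) (h₀ : Ω → ℝ) (h : ℕ → Ω → ℝ) : ℝ :=
  μ.real {ω | ENNReal.ofReal Ξ <
    sinr P η R σ ‖v₀‖ (1 * g₀) (fun _ => 1) (fun v => G (Complex.arg (v / v₀))) X h₀ h ω}

end IoTNetwork

end

open IoTNetwork

/-! Write `d = √3 R / 2`, let `λ` be the intensity, and let `c(v) = Ξ r₀^η G(θ) ‖v‖^(-η) / g₀` for
`‖v‖ ≥ d` and `0` otherwise, with `K = Ξ r₀^η σ² / (g₀ P)`. Clearing denominators, `SINR > Ξ`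
becomes `K + ∑ c(X i) h i < h₀`. Since `h₀` is exponential and independent of the rest, the
conditional probability is `exp(-K - ∑ c(X i) h i)`. Averaging over each `h i` turns its factor into
`1 / (1 + c(X i)) = exp(-log(1 + c(X i)))`; this is `fadingLaw_setOf_lt`.

What remains is the Laplace functional of the Poisson process at `φ = log(1 + c)`
(`IsPoissonPointProcess.lintegral_expNeg_tsum`). As `1 - e^(-φ) = c / (1 + c)`, it equals `exp(-λ ∫
c / (1 + c))`. In polar coordinates around the direction of `v₀`, the substitution `r = d t^(-1/η)`
makes the radial integral an Euler integral for `₂F₁(1, 1 - 2/η; 2 - 2/η; ·)`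
(`lintegral_Ici_interference`).

Sums and exponents live in `[0, ∞]`, where `exp(-∞) = 0`, so almost sure finiteness of the
interference is never needed. -/

namespace IoTNetwork

open Filter Topology

/-! ### The function `x ↦ exp (-x)` on `[0, ∞]` -/

/-- `exp (-x)` for `x ∈ [0, ∞]`. -/
noncomputable def expNeg (x : ℝ≥0∞) : ℝ≥0∞ := EReal.exp (-(x : EReal))

@[simp] theorem expNeg_zero : expNeg 0 = 1 := by simp [expNeg]

@[simp] theorem expNeg_top : expNeg ∞ = 0 := by simp [expNeg]

/-- Infinite arguments are harmless: the image of `[0, ∞]` in `EReal` avoids `⊥`, so no `∞ - ∞`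
arises. -/
theorem expNeg_add (x y : ℝ≥0∞) : expNeg (x + y) = expNeg x * expNeg y := by
  rw [expNeg, EReal.coe_ennreal_add, EReal.neg_add (.inl (EReal.coe_ennreal_ne_bot _))
    (.inr (EReal.coe_ennreal_ne_bot _)), sub_eq_add_neg, EReal.exp_add, expNeg, expNeg]

theorem expNeg_ofReal {r : ℝ} (hr : 0 ≤ r) :
    expNeg (ENNReal.ofReal r) = ENNReal.ofReal (Real.exp (-r)) := by
  rw [expNeg, EReal.coe_ennreal_ofReal, max_eq_left hr, ← EReal.coe_neg, EReal.exp_coe]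

theorem continuous_expNeg : Continuous expNeg :=
  EReal.expOrderIso.continuous.comp (continuous_neg.comp continuous_coe_ennreal_ereal)

theorem measurable_expNeg : Measurable expNeg := continuous_expNeg.measurable

theorem antitone_expNeg : Antitone expNeg := fun _ _ h =>
  EReal.exp_monotone (EReal.neg_le_neg_iff.2 (EReal.coe_ennreal_le_coe_ennreal_iff.2 h))

theorem expNeg_le_one (x : ℝ≥0∞) : expNeg x ≤ 1 := by
  simpa using antitone_expNeg (zero_le (a := x))

theorem expNeg_nat_mul (k : ℕ) (x : ℝ≥0∞) : expNeg (k * x) = expNeg x ^ k := by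
  induction k with
  | zero => simp
  | succ k ih => rw [Nat.cast_succ, add_mul, one_mul, expNeg_add, ih, pow_succ]

theorem expNeg_sum {ι : Type*} (s : Finset ι) (f : ι → ℝ≥0∞) :
    expNeg (∑ i ∈ s, f i) = ∏ i ∈ s, expNeg (f i) := by
  classical
  induction s using Finset.induction_on with
  | empty => simp
  | insert a s ha ih => rw [Finset.sum_insert ha, Finset.prod_insert ha, expNeg_add, ih]

/-- The Laplace transform of the Poisson distribution. -/
theorem lintegral_pow_poissonMeasure (r : ℝ≥0) {y : ℝ≥0∞} (hy : y ≤ 1) :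
    ∫⁻ k, y ^ k ∂(poissonMeasure r) = expNeg (r * (1 - y)) := by
  lift y to ℝ≥0 using ne_top_of_le_ne_top ENNReal.one_ne_top hy
  have hy : y ≤ 1 := by exact_mod_cast hy
  have h1 : (r : ℝ≥0∞) * (1 - y) = ENNReal.ofReal (r * (1 - y)) := by
    rw [ENNReal.ofReal_mul r.coe_nonneg, ENNReal.ofReal_sub _ y.coe_nonneg]
    simp
  have h2 : (0 : ℝ) ≤ r * (1 - y) := mul_nonneg r.coe_nonneg (sub_nonneg.2 (by exact_mod_cast hy))
  rw [h1, expNeg_ofReal h2, poissonMeasure, lintegral_sum_measure]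
  have h3 : HasSum (fun k : ℕ => Real.exp (-r) * r ^ k / k.factorial * y ^ k)
      (Real.exp (-(r * (1 - y)))) := by
    have := (NormedSpace.expSeries_div_hasSum_exp (𝔸 := ℝ) (r * y : ℝ)).mul_left (Real.exp (-r))
    rw [← Real.exp_eq_exp_ℝ, ← Real.exp_add] at this
    convert! this using 2
    · ring
    · ring
  rw [← h3.tsum_eq, ENNReal.ofReal_tsum_of_nonneg (fun k => by positivity) h3.summable]
  congr 1
  ext k
  rw [lintegral_smul_measure, lintegral_dirac, smul_eq_mul, ENNReal.ofReal_mul (by positivity)]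
  simp

/-! ### The Laplace functional of a Poisson point process -/

/-- Points are grouped by their value. The value `0` is left out because its fibre may have infinite
intensity, where `hasLaw_count` gives nothing. -/
theorem tsum_simpleFunc_eq_sum_mul_pointCount {Ω E : Type*} [MeasurableSpace E]
    (X : ℕ → Ω → E) (ψ : SimpleFunc E ℝ≥0∞) (ω : Ω) :
    ∑' i, ψ (X i ω) = ∑ a ∈ ψ.range.filter (· ≠ 0), pointCount X (ψ ⁻¹' {a}) ω * a := by
  simp_rw [pointCount, ← ENNReal.tsum_mul_right]
  rw [← Summable.tsum_finsetSum fun _ _ => ENNReal.summable]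
  refine tsum_congr fun i => ?_
  rw [Finset.sum_filter_of_ne (by rintro a - h rfl; simp at h),
    Finset.sum_eq_single (ψ (X i ω))]
  · simp
  · intro a _ ha
    simp [Ne.symm ha]
  · intro h
    exact absurd (ψ.mem_range_self _) h

section Laplace

variable {Ω E : Type*} [MeasurableSpace Ω] [MeasurableSpace E] {μ : Measure Ω}
  {X : ℕ → Ω → E} {Λ : Measure E}

theorem measurable_pointCount (hX : ∀ i, Measurable (X i)) {A : Set E} (hA : MeasurableSet A) :
    Measurable (pointCount X A) :=
  Measurable.tsum fun i => (measurable_const.indicator hA).comp (hX i)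

/-- This is the Poisson generating function at `y = expNeg a`; `a = ∞` is allowed. -/
theorem IsPoissonPointProcess.lintegral_expNeg_mul_pointCount (hX : IsPoissonPointProcess X Λ μ)
    {A : Set E} (hA : MeasurableSet A) (hΛ : Λ A ≠ ∞) (a : ℝ≥0∞) :
    ∫⁻ ω, expNeg (pointCount X A ω * a) ∂μ = expNeg (Λ A * (1 - expNeg a)) := by
  have hm : Measurable fun x : ℝ≥0∞ => expNeg (x * a) :=
    measurable_expNeg.comp (measurable_id.mul_const a)
  have h := hX.hasLaw_count A hA hΛ
  rw [← lintegral_map' (f := fun x => expNeg (x * a)) hm.aemeasurable h.aemeasurable, h.map_eq,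
    lintegral_map hm (measurable_of_countable _)]
  simp_rw [expNeg_nat_mul]
  rw [lintegral_pow_poissonMeasure _ (expNeg_le_one a), ENNReal.coe_toNNReal hΛ]

/-- Distinct fibres are disjoint, so their counts are independent and the expectation factorises.
The exponents then add up to the integral of the simple function `1 - expNeg ∘ ψ`. -/
theorem IsPoissonPointProcess.lintegral_expNeg_tsum_simpleFunc (hX : IsPoissonPointProcess X Λ μ)
    (ψ : SimpleFunc E ℝ≥0∞) (hψ : ∀ a ≠ 0, Λ (ψ ⁻¹' {a}) ≠ ∞) :
    ∫⁻ ω, expNeg (∑' i, ψ (X i ω)) ∂μ = expNeg (∫⁻ v, (1 - expNeg (ψ v)) ∂Λ) := by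
  set s := ψ.range.filter (· ≠ 0) with hs
  let e := s.equivFin.symm
  have hind := hX.indep_count s.card (fun j => ψ ⁻¹' {(e j : ℝ≥0∞)})
    (fun j => ψ.measurableSet_fiber _) (fun i j hij => by
      refine Disjoint.preimage _ (Set.disjoint_singleton.2 fun h => hij ?_)
      exact e.injective (Subtype.ext h))
  have hm : ∀ a : ℝ≥0∞, Measurable fun x : ℝ≥0∞ => expNeg (x * a) := fun a =>
    measurable_expNeg.comp (measurable_id.mul_const a)
  have hprod := lintegral_prod_eq_prod_lintegral_of_indepFun Finset.univ _
    (hind.comp (fun j x => expNeg (x * (e j : ℝ≥0∞))) fun j => hm _)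
    (fun j => (hm _).comp (measurable_pointCount hX.measurable (ψ.measurableSet_fiber _)))
  have hre : ∀ f : ℝ≥0∞ → ℝ≥0∞, ∏ a ∈ s, f a = ∏ j, f (e j) := fun f => by
    rw [← Finset.prod_coe_sort, ← e.prod_comp]
  simp_rw [tsum_simpleFunc_eq_sum_mul_pointCount X ψ, expNeg_sum, ← hs, hre]
  simp only [Function.comp_apply] at hprod
  rw [hprod]
  have hΛe : ∀ j, (e j : ℝ≥0∞) ≠ 0 := fun j => (Finset.mem_filter.1 (e j).2).2
  simp_rw [fun j => hX.lintegral_expNeg_mul_pointCount (ψ.measurableSet_fiber (e j))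
    (hψ _ (hΛe j)) (e j)]
  rw [← hre (fun a => expNeg (Λ (ψ ⁻¹' {a}) * (1 - expNeg a))), ← expNeg_sum]
  congr 1
  have : ∀ v, 1 - expNeg (ψ v) = ψ.map (fun a => 1 - expNeg a) v := fun v => rfl
  rw [lintegral_congr this, SimpleFunc.lintegral_eq_lintegral, SimpleFunc.map_lintegral, hs,
    Finset.sum_filter_of_ne (by rintro a - h rfl; simp at h)]
  simp_rw [mul_comm]

theorem measurable_tsum_comp (hX : ∀ i, Measurable (X i)) {φ : E → ℝ≥0∞} (hφ : Measurable φ) :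
    Measurable fun ω => ∑' i, φ (X i ω) :=
  Measurable.tsum fun i => hφ.comp (hX i)

/-- The Laplace functional of a Poisson point process. -/
theorem IsPoissonPointProcess.lintegral_expNeg_tsum [IsFiniteMeasure μ] [SigmaFinite Λ]
    (hX : IsPoissonPointProcess X Λ μ) {φ : E → ℝ≥0∞} (hφ : Measurable φ) :
    ∫⁻ ω, expNeg (∑' i, φ (X i ω)) ∂μ = expNeg (∫⁻ v, (1 - expNeg (φ v)) ∂Λ) := by
  -- Cutting the approximants off to sets of finite intensity makes every nonzero fibre finite, as
  -- the simple case requires.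
  let ψ : ℕ → SimpleFunc E ℝ≥0∞ := fun k =>
    (SimpleFunc.eapprox φ k).restrict (spanningSets Λ k)
  have hψ : ∀ k v, ψ k v = (spanningSets Λ k).indicator (SimpleFunc.eapprox φ k) v := fun k v => by
    rw [SimpleFunc.restrict_apply _ (measurableSet_spanningSets Λ k)]
  have hmono : ∀ v, Monotone fun k => ψ k v := by
    intro v k l hkl
    simp only [hψ]
    refine (Set.indicator_le_indicator_of_subset (monotone_spanningSets Λ hkl)
      (fun _ => zero_le) v).trans (Set.indicator_le_indicator ?_)
    exact SimpleFunc.monotone_eapprox φ hkl v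
  have hlim : ∀ v, Tendsto (fun k => ψ k v) atTop (𝓝 (φ v)) := by
    intro v
    refine (SimpleFunc.tendsto_eapprox hφ v).congr' ?_
    filter_upwards [eventually_ge_atTop (spanningSetsIndex Λ v)] with k hk
    rw [hψ, Set.indicator_of_mem (monotone_spanningSets Λ hk (mem_spanningSetsIndex Λ v))]
  have hsupp : ∀ k, ∀ a ≠ 0, Λ (ψ k ⁻¹' {a}) ≠ ∞ := by
    intro k a ha
    refine ((measure_mono fun v hv => ?_).trans_lt (measure_spanningSets_lt_top Λ k)).ne
    by_contra h
    rw [Set.mem_preimage, hψ, Set.indicator_of_notMem h] at hv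
    exact ha (Set.mem_singleton_iff.1 hv).symm
  have hsum : ∀ ω, Tendsto (fun k => ∑' i, ψ k (X i ω)) atTop (𝓝 (∑' i, φ (X i ω))) := by
    intro ω
    -- Read as an integral against counting measure, the sum over points obeys monotone convergence.
    simp_rw [← lintegral_count]
    exact lintegral_tendsto_of_tendsto_of_monotone (fun k => (measurable_of_countable _).aemeasurable)
      (Eventually.of_forall fun i => hmono _) (Eventually.of_forall fun i => hlim _)
  have hL : Tendsto (fun k => ∫⁻ ω, expNeg (∑' i, ψ k (X i ω)) ∂μ) atTop
      (𝓝 (∫⁻ ω, expNeg (∑' i, φ (X i ω)) ∂μ)) := by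
    refine tendsto_lintegral_of_dominated_convergence (fun _ => 1) (fun k =>
      measurable_expNeg.comp (measurable_tsum_comp hX.measurable (ψ k).measurable))
      (fun k => Eventually.of_forall fun ω => expNeg_le_one _) (by simp)
      (Eventually.of_forall fun ω => (continuous_expNeg.tendsto _).comp (hsum ω))
  have hR : Tendsto (fun k => ∫⁻ v, (1 - expNeg (ψ k v)) ∂Λ) atTop
      (𝓝 (∫⁻ v, (1 - expNeg (φ v)) ∂Λ)) := by
    refine lintegral_tendsto_of_tendsto_of_monotone
      (fun k => ((measurable_expNeg.comp (ψ k).measurable).const_sub 1).aemeasurable)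
      (Eventually.of_forall fun v k l hkl => tsub_le_tsub_left (antitone_expNeg (hmono v hkl)) 1)
      (Eventually.of_forall fun v => ?_)
    exact ENNReal.Tendsto.sub tendsto_const_nhds ((continuous_expNeg.tendsto _).comp (hlim v))
      (.inl ENNReal.one_ne_top)
  refine tendsto_nhds_unique hL (((continuous_expNeg.tendsto _).comp hR).congr fun k => ?_)
  exact (hX.lintegral_expNeg_tsum_simpleFunc (ψ k) (hsupp k)).symm

end Laplace

/-! ### Exponential fading -/

instance : IsProbabilityMeasure (expMeasure 1) := isProbabilityMeasure_expMeasure one_pos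

/-- The exponential tail, extended to `x = ∞` so that infinite interference means certain failure.
-/
theorem expMeasure_one_setOf_lt_ofReal (x : ℝ≥0∞) :
    expMeasure 1 {t | x < ENNReal.ofReal t} = expNeg x := by
  induction x with
  | top => simp
  | coe r =>
    have h1 : {t : ℝ | (r : ℝ≥0∞) < ENNReal.ofReal t} = (Iic (r : ℝ))ᶜ := by
      ext t
      rw [mem_ofPred_eq, ← ENNReal.ofReal_coe_nnreal, ENNReal.ofReal_lt_ofReal_iff_of_nonneg r.coe_nonneg]
      simp
    rw [h1, prob_compl_eq_one_sub measurableSet_Iic, ← ENNReal.ofReal_coe_nnreal,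
      expNeg_ofReal r.coe_nonneg, ← ofReal_cdf, cdf_expMeasure_eq one_pos, if_pos r.coe_nonneg,
      ← ENNReal.ofReal_one, ← ENNReal.ofReal_sub]
    · simp
    · simp

/-- The Laplace transform of the exponential distribution. -/
theorem lintegral_expNeg_mul_expMeasure_one {c : ℝ} (hc : 0 ≤ c) :
    ∫⁻ t, expNeg (ENNReal.ofReal c * ENNReal.ofReal t) ∂(expMeasure 1) =
      expNeg (ENNReal.ofReal (Real.log (1 + c))) := by
  have hm : Measurable fun t => expNeg (ENNReal.ofReal c * ENNReal.ofReal t) :=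
    measurable_expNeg.comp (by fun_prop)
  have hd : expMeasure 1 = volume.withDensity (exponentialPDF 1) := rfl
  have hpdf : ∀ r, Measurable (exponentialPDF r) := fun r =>
    (measurable_exponentialPDFReal r).ennreal_ofReal
  rw [hd, lintegral_withDensity_eq_lintegral_mul _ (hpdf 1) hm]
  -- Tilting the rate `1` density by `e^(-ct)` gives the rate `1 + c` density times `1 / (1 + c)`.
  have h : ∀ t, (exponentialPDF 1 * fun t => expNeg (ENNReal.ofReal c * ENNReal.ofReal t)) t =
      ENNReal.ofReal (1 / (1 + c)) * exponentialPDF (1 + c) t := by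
    intro t
    rcases lt_or_ge t 0 with ht | ht
    · simp [exponentialPDF_of_neg ht]
    · rw [Pi.mul_apply, exponentialPDF_of_nonneg ht, exponentialPDF_of_nonneg ht,
        ← ENNReal.ofReal_mul hc, expNeg_ofReal (by positivity), ← ENNReal.ofReal_mul (by positivity),
        ← ENNReal.ofReal_mul (by positivity), one_mul, ← Real.exp_add]
      congr 1
      field_simp
      ring_nf
  rw [lintegral_congr h, lintegral_const_mul _ (hpdf _),
    lintegral_exponentialPDF_eq_one (by linarith), mul_one,
    expNeg_ofReal (Real.log_nonneg (by linarith)), ← Real.log_inv,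
    Real.exp_log (by positivity), one_div]

/-- The joint law of countably many i.i.d. exponential fading gains. -/
noncomputable abbrev fadingLaw : Measure (Option ℕ → ℝ) :=
  Measure.infinitePi fun _ => expMeasure 1

theorem iIndepFun_fadingLaw : iIndepFun (fun (i : Option ℕ) (g : Option ℕ → ℝ) => g i) fadingLaw :=
  iIndepFun_infinitePi (X := fun _ x => x) fun _ => measurable_id

theorem measurable_tsum_mul_ofReal {α : Type*} [MeasurableSpace α] (c : ℕ → ℝ≥0∞)
    {g : ℕ → α → ℝ} (hg : ∀ i, Measurable (g i)) :
    Measurable fun a => ∑' i, c i * ENNReal.ofReal (g i a) :=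
  Measurable.tsum fun i => (ENNReal.measurable_ofReal.comp (hg i)).const_mul _

/-- The sum is measurable for the σ-algebra generated by the coordinates other than `none`. -/
theorem indepFun_tsum_fadingLaw (c : ℕ → ℝ≥0∞) :
    IndepFun (fun g : Option ℕ → ℝ => ∑' i, c i * ENNReal.ofReal (g (some i)))
      (fun g => g none) fadingLaw := by
  have h := indep_iSup_of_disjoint (fun i => (measurable_pi_apply i).comap_le)
    iIndepFun_fadingLaw.iIndep (S := {none}ᶜ) (T := {none}) disjoint_compl_left
  refine indep_of_indep_of_le_left (indep_of_indep_of_le_right h ?_) ?_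
  · exact le_iSup₂_of_le none rfl le_rfl
  · rw [← measurable_iff_comap_le]
    -- The explicit `(_)` selects that smaller σ-algebra instead of the product instance.
    refine @measurable_tsum_mul_ofReal _ (_) c _ fun i => ?_
    exact (comap_measurable fun g : Option ℕ → ℝ => g (some i)).mono
      (le_iSup₂_of_le (some i) (by simp) le_rfl) le_rfl

/-- Partial sums factorise by independence, and both sides pass to the limit because `expNeg` is
continuous and at most `1`. The logarithms turn the product over points into a sum, the form that
the Laplace functional accepts. -/
theorem lintegral_expNeg_tsum_fadingLaw {c : ℕ → ℝ} (hc : ∀ i, 0 ≤ c i) :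
    ∫⁻ g, expNeg (∑' i, ENNReal.ofReal (c i) * ENNReal.ofReal (g (some i))) ∂fadingLaw =
      expNeg (∑' i, ENNReal.ofReal (Real.log (1 + c i))) := by
  have hm : ∀ i, Measurable fun g : Option ℕ → ℝ =>
      ENNReal.ofReal (c i) * ENNReal.ofReal (g (some i)) := fun i => by fun_prop
  have hL : Tendsto (fun N => ∫⁻ g, expNeg (∑ i ∈ Finset.range N,
      ENNReal.ofReal (c i) * ENNReal.ofReal (g (some i))) ∂fadingLaw) atTop
      (𝓝 (∫⁻ g, expNeg (∑' i, ENNReal.ofReal (c i) * ENNReal.ofReal (g (some i))) ∂fadingLaw)) := by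
    refine tendsto_lintegral_of_dominated_convergence (fun _ => 1) (fun N =>
      measurable_expNeg.comp (Finset.measurable_sum _ fun i _ => hm i))
      (fun N => Eventually.of_forall fun g => expNeg_le_one _) (by simp)
      (Eventually.of_forall fun g =>
        (continuous_expNeg.tendsto _).comp ENNReal.summable.hasSum.tendsto_sum_nat)
  have hR := (continuous_expNeg.tendsto _).comp
    (ENNReal.summable (f := fun i => ENNReal.ofReal (Real.log (1 + c i)))).hasSum.tendsto_sum_nat
  refine tendsto_nhds_unique hL (hR.congr fun N => ?_)
  have hind := (iIndepFun_fadingLaw.precomp (Option.some_injective ℕ)).comp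
    (fun i t => expNeg (ENNReal.ofReal (c i) * ENNReal.ofReal t))
    (fun i => measurable_expNeg.comp (by fun_prop))
  have := lintegral_prod_eq_prod_lintegral_of_indepFun (Finset.range N) _ hind
    (fun i => measurable_expNeg.comp (hm i))
  simp only [Function.comp_apply] at this ⊢
  simp_rw [expNeg_sum]
  rw [this]
  refine Finset.prod_congr rfl fun i _ => ?_
  rw [← lintegral_expNeg_mul_expMeasure_one (hc i),
    ← Measure.infinitePi_map_eval (fun _ : Option ℕ => expMeasure 1) (some i),
    lintegral_map ?_ (measurable_pi_apply _)]
  exact measurable_expNeg.comp (g := expNeg) (by fun_prop)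

/-- The success probability given the locations of the interferers. -/
theorem fadingLaw_setOf_lt (K : ℝ≥0∞) {c : ℕ → ℝ} (hc : ∀ i, 0 ≤ c i) :
    fadingLaw {g | K + ∑' i, ENNReal.ofReal (c i) * ENNReal.ofReal (g (some i)) <
      ENNReal.ofReal (g none)} =
      expNeg K * expNeg (∑' i, ENNReal.ofReal (Real.log (1 + c i))) := by
  set S : (Option ℕ → ℝ) → ℝ≥0∞ := fun g =>
    ∑' i, ENNReal.ofReal (c i) * ENNReal.ofReal (g (some i)) with hS
  have hSm : Measurable S := measurable_tsum_mul_ofReal _ fun i => measurable_pi_apply _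
  have hmap := (indepFun_tsum_fadingLaw fun i => ENNReal.ofReal (c i)).map_prod_eq_prod_map_map
    hSm.aemeasurable (measurable_pi_apply none).aemeasurable
  have hset : MeasurableSet {p : ℝ≥0∞ × ℝ | K + p.1 < ENNReal.ofReal p.2} :=
    measurableSet_lt (by fun_prop) (by fun_prop)
  have h1 : {g | K + S g < ENNReal.ofReal (g none)} =
      (fun g => (S g, g none)) ⁻¹' {p : ℝ≥0∞ × ℝ | K + p.1 < ENNReal.ofReal p.2} := rfl
  -- Fubini for the product law of `S` and `g none`: with `S` frozen, the inner measure is an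
  -- exponential tail.
  rw [h1, ← Measure.map_apply (hSm.prodMk (measurable_pi_apply none)) hset, hmap,
    Measure.prod_apply hset, Measure.infinitePi_map_eval, ← lintegral_expNeg_tsum_fadingLaw hc,
    lintegral_map (measurable_measure_prodMk_left hset) hSm,
    ← lintegral_const_mul (f := fun g => expNeg (S g)) _ (measurable_expNeg.comp hSm)]
  refine lintegral_congr fun g => ?_
  rw [← expNeg_add, ← expMeasure_one_setOf_lt_ofReal]
  rfl

/-! ### Euler's integral and the interference integral -/

/-- Euler's integral is the continuation of the Gauss series with parameters `1`, `b`, `b + 1`. -/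
theorem isGaussHypergeometric_eulerIntegral {b : ℝ} (hb : 0 < b) :
    IsGaussHypergeometric 1 b (b + 1)
      (fun x => b * ∫ t in Ioc (0 : ℝ) 1, t ^ (b - 1) / (1 - x * t)) := by
  -- Passing to complex `z` reduces analyticity to differentiation under the integral sign.
  let g : ℂ → ℂ := fun z => ∫ t in Ioc (0 : ℝ) 1, ((t ^ (b - 1) : ℝ) : ℂ) / (1 - z * t)
  have hint : IntegrableOn (fun t : ℝ => t ^ (b - 1)) (Ioc 0 1) :=
    (intervalIntegrable_iff_integrableOn_Ioc_of_le zero_le_one).1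
      (intervalIntegral.intervalIntegrable_rpow' (by linarith))
  have hmeas : ∀ z : ℂ, AEStronglyMeasurable
      (fun t : ℝ => ((t ^ (b - 1) : ℝ) : ℂ) / (1 - z * t)) (volume.restrict (Ioc 0 1)) := by
    intro z
    exact Measurable.aestronglyMeasurable (by fun_prop)
  -- The real part `1 - t Re z` is the convex combination `(1 - t) · 1 + t (1 - Re z)`.
  have hden : ∀ {δ : ℝ} {z : ℂ} {t : ℝ}, δ ≤ 1 → δ ≤ 1 - z.re → t ∈ Ioc (0 : ℝ) 1 →
      δ ≤ ‖1 - z * t‖ := by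
    intro δ z t h1 h2 ht
    refine le_trans ?_ (Complex.re_le_norm _)
    simp
    nlinarith [ht.1, ht.2]
  have hdiff : DifferentiableOn ℂ g {z | z.re < 1} := by
    intro z hz
    have hz : z.re < 1 := hz
    -- At most half the distance to the line `Re = 1`, so a ball of radius `δ` stays `δ` away from
    -- it.
    obtain ⟨δ, hδ, hδ1, hδz⟩ : ∃ δ : ℝ, 0 < δ ∧ δ ≤ 1 ∧ δ + δ ≤ 1 - z.re :=
      ⟨min 1 ((1 - z.re) / 2), by simp; linarith, min_le_left _ _,
        by linarith [min_le_right 1 ((1 - z.re) / 2)]⟩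
    have hball : ∀ w ∈ Metric.ball z δ, δ ≤ 1 - w.re := by
      intro w hw
      have := (Complex.abs_re_le_norm (w - z)).trans_lt (mem_ball_iff_norm.1 hw)
      rw [Complex.sub_re, abs_lt] at this
      linarith [this.2]
    have := (hasDerivAt_integral_of_dominated_loc_of_deriv_le (𝕜 := ℂ)
      (μ := volume.restrict (Ioc (0:ℝ) 1))
      (F := fun z t => ((t ^ (b - 1) : ℝ) : ℂ) / (1 - z * t))
      (F' := fun z t => ((t ^ (b - 1) : ℝ) : ℂ) * t / (1 - z * t) ^ 2)
      (x₀ := z) (bound := fun t => t ^ (b - 1) / δ ^ 2) (Metric.ball_mem_nhds z hδ)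
      (Filter.Eventually.of_forall hmeas) ?_ ?_ ?_ (hint.div_const _) ?_).2
    · exact this.differentiableAt.differentiableWithinAt
    · refine Integrable.mono' (hint.div_const δ) (hmeas z) ?_
      filter_upwards [ae_restrict_mem measurableSet_Ioc] with t ht
      rw [norm_div, Complex.norm_real, Real.norm_of_nonneg (Real.rpow_nonneg ht.1.le _)]
      exact div_le_div_of_nonneg_left (Real.rpow_nonneg ht.1.le _) hδ
        (hden hδ1 (by linarith) ht)
    · exact Measurable.aestronglyMeasurable (by fun_prop)
    · filter_upwards [ae_restrict_mem measurableSet_Ioc] with t ht w hw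
      rw [norm_div, norm_mul, norm_pow, Complex.norm_real, Complex.norm_real,
        Real.norm_of_nonneg (Real.rpow_nonneg ht.1.le _), Real.norm_of_nonneg ht.1.le]
      have h1 := hden hδ1 (hball w hw) ht
      have h2 := Real.rpow_nonneg ht.1.le (b - 1)
      refine div_le_div₀ h2 ?_ (by positivity) (by gcongr)
      nlinarith [ht.2]
    · filter_upwards [ae_restrict_mem measurableSet_Ioc] with t ht w hw
      have h1 := hden hδ1 (hball w hw) ht
      have h2 : (1 - w * t) ≠ 0 := norm_pos_iff.1 (hδ.trans_le h1)
      have h3 : HasDerivAt (fun w : ℂ => 1 - w * t) (-(1 * (t : ℂ))) w :=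
        ((hasDerivAt_id w).mul_const _).const_sub 1
      refine ((hasDerivAt_const w ((t ^ (b - 1) : ℝ) : ℂ)).div h3 h2).congr_deriv ?_
      ring
  have hopen : IsOpen {z : ℂ | z.re < 1} := isOpen_lt Complex.continuous_re continuous_const
  have han := (hdiff.analyticOnNhd hopen)
  have hreal : ∀ x : ℝ, (b * (g x).re) =
      b * ∫ t in Ioc (0:ℝ) 1, t ^ (b - 1) / (1 - x * t) := by
    intro x
    have : g x = ((∫ t in Ioc (0:ℝ) 1, t ^ (b - 1) / (1 - x * t) : ℝ) : ℂ) := by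
      rw [← integral_complex_ofReal]
      simp [g]
    rw [this, Complex.ofReal_re]
  have hfun : (fun x : ℝ => b * ∫ t in Ioc (0 : ℝ) 1, t ^ (b - 1) / (1 - x * t)) =
      fun x : ℝ => b * (g x).re := funext fun x => (hreal x).symm
  rw [hfun]
  refine ⟨?_, ?_⟩
  · intro x hx
    have h1 : AnalyticAt ℝ g (x : ℂ) := (han x (by simpa using hx)).restrictScalars
    have h2 : AnalyticAt ℝ (fun x : ℝ => g x) x :=
      AnalyticAt.fun_comp (f := fun x : ℝ => (x : ℂ)) h1 (Complex.ofRealCLM.analyticAt x)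
    exact analyticAt_const.mul ((Complex.reCLM.analyticAt _).comp h2)
  · intro x hx
    show b * (g x).re = _
    rw [hreal, ordinaryHypergeometric_eq_tsum]
    simp only [gaussCoefficient_eq hb, smul_eq_mul]
    have hI : ∀ n : ℕ, ∫ t in Ioc (0:ℝ) 1, t ^ (b - 1) * (x * t) ^ n = x ^ n / (b + n) := by
      intro n
      have : ∀ t ∈ Ioc (0:ℝ) 1, t ^ (b - 1) * (x * t) ^ n = x ^ n * t ^ (b - 1 + n) := by
        intro t ht
        rw [Real.rpow_add_natCast ht.1.ne', mul_pow]; ring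
      rw [setIntegral_congr_fun measurableSet_Ioc this, integral_const_mul,
        ← intervalIntegral.integral_of_le zero_le_one,
        integral_rpow (Or.inl (by have : (0:ℝ) ≤ n := by positivity
                                  linarith))]
      have : (0:ℝ) < b + n := by positivity
      have h0 : b - 1 + n + 1 = b + n := by ring
      rw [h0, Real.one_rpow, Real.zero_rpow this.ne']
      ring
    -- The geometric series of `1 / (1 - x t)` is integrated term by term, dominated by `t^(b-1)
    -- |x|^n`.
    have hs := hasSum_integral_of_dominated_convergence (μ := volume.restrict (Ioc (0:ℝ) 1))
      (F := fun (n : ℕ) t => t ^ (b - 1) * (x * t) ^ n)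
      (f := fun t => t ^ (b - 1) / (1 - x * t))
      (fun n t => t ^ (b - 1) * |x| ^ n) ?_ ?_ ?_ ?_ ?_
    · simp only [hI] at hs
      rw [← hs.tsum_eq, ← tsum_mul_left]
      congr 1
      ext n
      ring
    · intro n
      exact Measurable.aestronglyMeasurable (by fun_prop)
    · intro n
      filter_upwards [ae_restrict_mem measurableSet_Ioc] with t ht
      rw [norm_mul, Real.norm_of_nonneg (Real.rpow_nonneg ht.1.le _), norm_pow, Real.norm_eq_abs,
        abs_mul, abs_of_pos ht.1]
      refine mul_le_mul_of_nonneg_left ?_ (Real.rpow_nonneg ht.1.le (b - 1))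
      exact pow_le_pow_left₀ (mul_nonneg (abs_nonneg x) ht.1.le)
        (mul_le_of_le_one_right (abs_nonneg x) ht.2) n
    · exact Filter.Eventually.of_forall fun t =>
        (summable_geometric_of_lt_one (abs_nonneg x) hx).mul_left _
    · simp only [tsum_mul_left]
      exact hint.mul_const _
    · filter_upwards [ae_restrict_mem measurableSet_Ioc] with t ht
      rw [div_eq_mul_inv]
      refine (hasSum_geometric_of_abs_lt_one ?_).mul_left _
      rw [abs_mul, abs_of_pos ht.1]
      nlinarith [ht.2, abs_nonneg x]

/-- `gauss2F1` is obtained by choice; uniqueness of the continuation on `Iio 1` is what gives it a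
formula. -/
theorem gauss2F1_eq_eulerIntegral {b x : ℝ} (hb : 0 < b) (hx : x < 1) :
    gauss2F1 1 b (b + 1) x = b * ∫ t in Ioc (0 : ℝ) 1, t ^ (b - 1) / (1 - x * t) :=
  (isGaussHypergeometric_gauss2F1 hb).eqOn (isGaussHypergeometric_eulerIntegral hb) hx

theorem one_sub_expNeg_log {c : ℝ} (hc : 0 ≤ c) :
    1 - expNeg (ENNReal.ofReal (Real.log (1 + c))) = ENNReal.ofReal (c / (1 + c)) := by
  rw [expNeg_ofReal (Real.log_nonneg (by linarith)), ← Real.log_inv, Real.exp_log (by positivity),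
    ← ENNReal.ofReal_one, ← ENNReal.ofReal_sub _ (by positivity)]
  congr 1
  field_simp
  ring

/-- The range of the substitution `r = d t^p`; a negative `p` sends `t → 0` to `r → ∞`. -/
theorem image_mul_rpow_neg_Ioc {d p : ℝ} (hd : 0 < d) (hp : p < 0) :
    (fun t : ℝ => d * t ^ p) '' Ioc 0 1 = Ici d := by
  ext r
  constructor
  · rintro ⟨t, ht, rfl⟩
    exact le_mul_of_one_le_right hd.le (Real.one_le_rpow_of_pos_of_le_one_of_nonpos ht.1 ht.2 hp.le)
  · intro hr
    have hr : d ≤ r := hr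
    have h1 : 1 ≤ r / d := (one_le_div hd).2 hr
    have h0 : 0 < r / d := by positivity
    refine ⟨(r / d) ^ p⁻¹, ⟨Real.rpow_pos_of_pos h0 _,
      Real.rpow_le_one_of_one_le_of_nonpos h1 (inv_nonpos.2 hp.le)⟩, ?_⟩
    simp only
    rw [← Real.rpow_mul h0.le, inv_mul_cancel₀ hp.ne, Real.rpow_one]
    field_simp

/-- The integral over the distance of the interferers seen under a fixed angle. -/
theorem lintegral_Ici_interference {c d η : ℝ} (hc : 0 ≤ c) (hd : 0 < d) (hη : 2 < η) :
    ∫⁻ r in Ici d, ENNReal.ofReal r *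
        ENNReal.ofReal (c * r ^ (-η) / (1 + c * r ^ (-η))) =
      ENNReal.ofReal (c * d ^ (2 - η) / (η - 2) *
        gauss2F1 1 (1 - 2 / η) (2 - 2 / η) (-c / d ^ η)) := by
  have hη0 : 0 < η := by linarith
  have hb : 0 < 1 - 2 / η := by
    rw [sub_pos, div_lt_one hη0]; exact hη
  have hp : -1 / η < 0 := div_neg_of_neg_of_pos (by norm_num) hη0
  set z := -c / d ^ η with hz
  have hdη : 0 < d ^ η := Real.rpow_pos_of_pos hd _
  have hz0 : z ≤ 0 := div_nonpos_of_nonpos_of_nonneg (by linarith) hdη.le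
  -- Substitute `r = d t^(-1/η)`, so that `c r^(-η) = (c / d^η) t = -z t`.
  rw [show (2 - 2 / η) = (1 - 2 / η) + 1 by ring,
    gauss2F1_eq_eulerIntegral hb (by linarith), ← image_mul_rpow_neg_Ioc hd hp,
    lintegral_image_eq_lintegral_abs_deriv_mul measurableSet_Ioc
      (f' := fun t => d * (-1 / η * t ^ (-1 / η - 1)))]
  rotate_left
  · intro t ht
    exact ((Real.hasDerivAt_rpow_const (Or.inl ht.1.ne')).const_mul d).hasDerivWithinAt
  · intro s hs t ht hst
    exact Real.rpow_left_injOn hp.ne hs.1.le ht.1.le (mul_left_cancel₀ hd.ne' hst)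
  have hden : ∀ t ∈ Ioc (0 : ℝ) 1, 1 ≤ 1 - z * t := fun t ht => by nlinarith [ht.1]
  have hcongr : ∀ t ∈ Ioc (0 : ℝ) 1,
      ENNReal.ofReal |d * (-1 / η * t ^ (-1 / η - 1))| * (ENNReal.ofReal (d * t ^ (-1 / η)) *
        ENNReal.ofReal (c * (d * t ^ (-1 / η)) ^ (-η) / (1 + c * (d * t ^ (-1 / η)) ^ (-η)))) =
      ENNReal.ofReal (c * d ^ (2 - η) / η * (t ^ (1 - 2 / η - 1) / (1 - z * t))) := by
    intro t ht
    have ht0 := ht.1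
    have h1 : (d * t ^ (-1 / η)) ^ (-η) = t / d ^ η := by
      rw [Real.mul_rpow hd.le (by positivity), ← Real.rpow_mul ht0.le,
        show -1 / η * -η = 1 by field_simp, Real.rpow_one, Real.rpow_neg hd.le]
      ring
    have h2 : |d * (-1 / η * t ^ (-1 / η - 1))| = d * (1 / η * t ^ (-1 / η - 1)) := by
      rw [show d * (-1 / η * t ^ (-1 / η - 1)) = -(d * (1 / η * t ^ (-1 / η - 1))) by ring, abs_neg,
        abs_of_nonneg (by positivity)]
    have h3 : t ^ (1 - 2 / η - 1) = t ^ (-1 / η - 1) * t ^ (-1 / η) * t := by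
      rw [← Real.rpow_add ht0, ← Real.rpow_add_one ht0.ne']
      congr 1
      ring
    have h4 : d ^ (2 - η) = d ^ 2 / d ^ η := by
      rw [Real.rpow_sub hd]
      norm_cast
    rw [h1, h2, h3, h4, ← ENNReal.ofReal_mul (by positivity), ← ENNReal.ofReal_mul (by positivity),
      show 1 + c * (t / d ^ η) = 1 - z * t by rw [hz]; ring]
    congr 1
    have := (zero_lt_one.trans_le (hden t ht)).ne'
    field_simp
  rw [setLIntegral_congr_fun measurableSet_Ioc hcongr, ← ofReal_integral_eq_lintegral_ofReal]
  -- The Euler prefactor `1 - 2/η` accounts for the constants: `(1 - 2/η) / (η - 2) = 1/η`.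
  · rw [integral_const_mul]
    congr 1
    have : η - 2 ≠ 0 := by linarith
    field_simp
  · refine Integrable.const_mul (Integrable.mono' (g := fun t : ℝ => t ^ (1 - 2 / η - 1)) ?_
      (Measurable.aestronglyMeasurable (by fun_prop)) ?_) _
    · exact (intervalIntegrable_iff_integrableOn_Ioc_of_le zero_le_one).1
        (intervalIntegral.intervalIntegrable_rpow' (by linarith))
    · filter_upwards [ae_restrict_mem measurableSet_Ioc] with t ht
      have h1 := hden t ht
      have h2 : 0 ≤ t ^ (1 - 2 / η - 1) := Real.rpow_nonneg ht.1.le _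
      rw [Real.norm_of_nonneg (by positivity)]
      exact div_le_self h2 h1
  · filter_upwards [ae_restrict_mem measurableSet_Ioc] with t ht
    have h1 := hden t ht
    have h2 : 0 ≤ t ^ (1 - 2 / η - 1) := Real.rpow_nonneg ht.1.le _
    have h3 : 0 < η - 2 := by linarith
    exact mul_nonneg (by positivity) (by positivity)

/-- Polar coordinates in which the angle is measured from the direction of `v₀`. -/
theorem lintegral_norm_arg_div {v₀ : ℂ} (hv₀ : v₀ ≠ 0) {F : ℝ → ℝ → ℝ≥0∞}
    (hF : Measurable (Function.uncurry F)) :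
    ∫⁻ v : ℂ, F ‖v‖ (Complex.arg (v / v₀)) =
      ∫⁻ θ in Ioo (-Real.pi) Real.pi, ∫⁻ r in Ioi 0, ENNReal.ofReal r * F r θ := by
  have hn : 0 < ‖v₀‖ := norm_pos_iff.2 hv₀
  -- Rotation by the direction of `v₀` preserves area and norm, and turns `arg (v / v₀)` into `arg
  -- w`.
  let a : Circle := ⟨v₀ / ‖v₀‖, by simp [Submonoid.unitSphere, hv₀]⟩
  have ha : ∀ w : ℂ, rotation a w / v₀ = (‖v₀‖⁻¹ : ℝ) * w := by
    intro w
    have : (‖v₀‖ : ℂ) ≠ 0 := by exact_mod_cast hn.ne'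
    rw [rotation_apply]
    simp only [a]
    push_cast
    field_simp
  rw [← (rotation a).measurePreserving.lintegral_comp_emb
    (rotation a).toHomeomorph.measurableEmbedding]
  simp_rw [LinearIsometryEquiv.norm_map, ha, Complex.arg_real_mul _ (inv_pos.2 hn)]
  rw [← Complex.lintegral_comp_polarCoord_symm]
  have htarget : polarCoord.target = Ioi (0 : ℝ) ×ˢ Ioo (-Real.pi) Real.pi := rfl
  have h : ∀ p ∈ polarCoord.target, ENNReal.ofReal p.1 • F ‖Complex.polarCoord.symm p‖
      (Complex.arg (Complex.polarCoord.symm p)) = ENNReal.ofReal p.1 * F p.1 p.2 := by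
    rintro ⟨r, θ⟩ hp
    have hr : 0 < r := hp.1
    rw [Complex.norm_polarCoord_symm, Complex.polarCoord_symm_apply, abs_of_pos hr]
    simp only [Complex.ofReal_cos, Complex.ofReal_sin]
    rw [Complex.arg_mul_cos_add_sin_mul_I hr (Ioo_subset_Ioc_self hp.2), smul_eq_mul]
  rw [setLIntegral_congr_fun polarCoord.open_target.measurableSet h, htarget,
    Measure.volume_eq_prod, ← Measure.prod_restrict, lintegral_prod_symm]
  exact ((ENNReal.measurable_ofReal.comp measurable_fst).mul hF).aemeasurable

/-! ### The success probability -/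

theorem PPPModel.hasLaw_gains {Ω : Type*} [MeasurableSpace Ω] {μ : Measure Ω} {lam : ℝ}
    {X : ℕ → Ω → ℂ} {h₀ : Ω → ℝ} {h : ℕ → Ω → ℝ} (hM : PPPModel μ lam X h₀ h) :
    HasLaw (fun ω (i : Option ℕ) => i.elim h₀ h ω) fadingLaw μ := by
  have hlaw : ∀ i : Option ℕ, HasLaw (i.elim h₀ h) (expMeasure 1) μ := by
    rintro (_ | i)
    · exact hM.law_h₀
    · exact hM.law_h i
  exact hM.indep_gains.hasLaw_infinitePi hlaw (aemeasurable_pi_iff.2 fun i => (hlaw i).aemeasurable)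

section SuccessProbability

variable {Ω : Type*} [MeasurableSpace Ω] {μ : Measure Ω} [IsProbabilityMeasure μ]
  {lam : ℝ} {X : ℕ → Ω → ℂ} {h₀ : Ω → ℝ} {h : ℕ → Ω → ℝ}

/-- The probability that the fading gain of the intended link exceeds a constant plus the faded sum
of the path gains `c` of the interferers. -/
theorem PPPModel.measure_add_tsum_lt (hM : PPPModel μ lam X h₀ h) (K : ℝ≥0∞) {c : ℂ → ℝ}
    (hcm : Measurable c) (hc : ∀ v, 0 ≤ c v) :
    μ {ω | K + ∑' i, ENNReal.ofReal (c (X i ω)) * ENNReal.ofReal (h i ω) <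
      ENNReal.ofReal (h₀ ω)} =
      expNeg K * expNeg (ENNReal.ofReal lam * ∫⁻ v, ENNReal.ofReal (c v / (1 + c v))) := by
  have hXm : Measurable fun ω (i : ℕ) => X i ω := measurable_pi_iff.2 hM.poisson.measurable
  have hg := hM.hasLaw_gains
  set S : Set ((ℕ → ℂ) × (Option ℕ → ℝ)) := {p | K + ∑' i, ENNReal.ofReal (c (p.1 i)) *
    ENNReal.ofReal (p.2 (some i)) < ENNReal.ofReal (p.2 none)} with hS
  have hSm : MeasurableSet S := by
    refine measurableSet_lt (measurable_const.add (Measurable.tsum fun i => ?_)) (by fun_prop)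
    exact (hcm.comp ((measurable_pi_apply i).comp measurable_fst)).ennreal_ofReal.mul (by fun_prop)
  have hset : {ω | K + ∑' i, ENNReal.ofReal (c (X i ω)) * ENNReal.ofReal (h i ω) <
      ENNReal.ofReal (h₀ ω)} =
      (fun ω => ((fun i => X i ω), fun (i : Option ℕ) => i.elim h₀ h ω)) ⁻¹' S := rfl
  have hmap := hM.indep_locations.map_prod_eq_prod_map_map hXm.aemeasurable hg.aemeasurable
  rw [hset, ← Measure.map_apply_of_aemeasurable (hXm.aemeasurable.prodMk hg.aemeasurable) hSm,
    hmap, hg.map_eq, Measure.prod_apply hSm, lintegral_map (measurable_measure_prodMk_left hSm) hXm]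
  have hφ : Measurable fun v => ENNReal.ofReal (Real.log (1 + c v)) :=
    (Real.measurable_log.comp (hcm.const_add 1)).ennreal_ofReal
  -- With the locations frozen, which independence permits, only the gains are random.
  have hin : ∀ ω, fadingLaw (Prod.mk (fun i => X i ω) ⁻¹' S) =
      expNeg K * expNeg (∑' i, ENNReal.ofReal (Real.log (1 + c (X i ω)))) := fun ω =>
    fadingLaw_setOf_lt K fun i => hc (X i ω)
  simp_rw [hin]
  have hψ : Measurable fun ω => expNeg (∑' i, ENNReal.ofReal (Real.log (1 + c (X i ω)))) :=
    measurable_expNeg.comp (measurable_tsum_comp hM.poisson.measurable hφ)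
  have : SigmaFinite (ENNReal.ofReal lam • (volume : Measure ℂ)) :=
    inferInstanceAs (SigmaFinite (lam.toNNReal • (volume : Measure ℂ)))
  rw [lintegral_const_mul _ hψ,
    hM.poisson.lintegral_expNeg_tsum hφ, lintegral_smul_measure, smul_eq_mul]
  simp_rw [one_sub_expNeg_log (hc _)]

/-- The path gains of the interferers relative to that of the intended link, scaled by the decoding
threshold. -/
noncomputable def relativeGain (G : ℝ → ℝ) (κ η d : ℝ) (r θ : ℝ) : ℝ :=
  (Ici d).indicator (fun r => κ * G θ * r ^ (-η)) r

theorem relativeGain_nonneg {G : ℝ → ℝ} (hG : ∀ θ, 0 ≤ G θ) {κ η d : ℝ} (hκ : 0 ≤ κ) (hd : 0 ≤ d)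
    (r θ : ℝ) : 0 ≤ relativeGain G κ η d r θ :=
  indicator_nonneg (fun _ hr => mul_nonneg (mul_nonneg hκ (hG θ))
    (Real.rpow_nonneg (hd.trans hr) _)) r

theorem measurable_relativeGain {G : ℝ → ℝ} (hG : Measurable G) (κ η d : ℝ) :
    Measurable (Function.uncurry (relativeGain G κ η d)) := by
  have : Function.uncurry (relativeGain G κ η d) =
      (Prod.fst ⁻¹' Ici d).indicator fun p : ℝ × ℝ => κ * G p.2 * p.1 ^ (-η) := by
    ext p
    simp [Function.uncurry, relativeGain, indicator]
  rw [this]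
  exact Measurable.indicator (by fun_prop) (measurable_fst measurableSet_Ici)

theorem gauss2F1_nonneg {b x : ℝ} (hb : 0 < b) (hx : x < 1) : 0 ≤ gauss2F1 1 b (b + 1) x := by
  rw [gauss2F1_eq_eulerIntegral hb hx]
  refine mul_nonneg hb.le (setIntegral_nonneg measurableSet_Ioc fun t ht => ?_)
  exact div_nonneg (Real.rpow_nonneg ht.1.le _) (by nlinarith [ht.1, ht.2])

theorem continuousOn_gauss2F1 {b : ℝ} (hb : 0 < b) :
    ContinuousOn (gauss2F1 1 b (b + 1)) (Iio 1) :=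
  (isGaussHypergeometric_gauss2F1 hb).1.continuousOn

/-- The exponent that the interference contributes to the success probability. -/
theorem lintegral_relativeGain {G : ℝ → ℝ} (hG : Continuous G) (hG0 : ∀ θ, 0 ≤ G θ)
    (hGp : Function.Periodic G (2 * Real.pi)) {κ η d : ℝ} (hκ : 0 ≤ κ) (hη : 2 < η) (hd : 0 < d)
    {v₀ : ℂ} (hv₀ : v₀ ≠ 0) :
    ∫⁻ v : ℂ, ENNReal.ofReal (relativeGain G κ η d ‖v‖ (Complex.arg (v / v₀)) /
      (1 + relativeGain G κ η d ‖v‖ (Complex.arg (v / v₀)))) =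
      ENNReal.ofReal (∫ θ in (0 : ℝ)..(2 * Real.pi), κ * G θ * d ^ (2 - η) / (η - 2) *
        gauss2F1 1 (1 - 2 / η) (2 - 2 / η) (-(κ * G θ) / d ^ η)) ∧
    0 ≤ ∫ θ in (0 : ℝ)..(2 * Real.pi), κ * G θ * d ^ (2 - η) / (η - 2) *
        gauss2F1 1 (1 - 2 / η) (2 - 2 / η) (-(κ * G θ) / d ^ η) := by
  have hb : 0 < 1 - 2 / η := by
    rw [sub_pos, div_lt_one (by linarith)]; exact hη
  have hb1 : 2 - 2 / η = (1 - 2 / η) + 1 := by ring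
  have hκG : ∀ θ, 0 ≤ κ * G θ := fun θ => mul_nonneg hκ (hG0 θ)
  have harg : ∀ θ, -(κ * G θ) / d ^ η < 1 := fun θ =>
    (div_nonpos_of_nonpos_of_nonneg (neg_nonpos.2 (hκG θ))
      (Real.rpow_nonneg hd.le _)).trans_lt one_pos
  set J : ℝ → ℝ := fun θ => κ * G θ * d ^ (2 - η) / (η - 2) *
    gauss2F1 1 (1 - 2 / η) (2 - 2 / η) (-(κ * G θ) / d ^ η) with hJ
  have hJ0 : ∀ θ, 0 ≤ J θ := fun θ => by
    have h1 : 0 ≤ κ * G θ * d ^ (2 - η) / (η - 2) :=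
      div_nonneg (mul_nonneg (hκG θ) (Real.rpow_nonneg hd.le _)) (by linarith)
    have h2 := gauss2F1_nonneg hb (harg θ)
    rw [← hb1] at h2
    exact mul_nonneg h1 h2
  have hJc : Continuous J := by
    have h1 : Continuous fun θ => gauss2F1 1 (1 - 2 / η) (2 - 2 / η) (-(κ * G θ) / d ^ η) := by
      rw [hb1]
      exact (continuousOn_gauss2F1 hb).comp_continuous (by fun_prop) harg
    exact Continuous.mul (by fun_prop) h1
  have hJp : Function.Periodic J (2 * Real.pi) := fun θ => by simp only [hJ, hGp θ]
  refine ⟨?_, intervalIntegral.integral_nonneg Real.two_pi_pos.le fun θ _ => hJ0 θ⟩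
  rw [lintegral_norm_arg_div hv₀ (F := fun r θ => ENNReal.ofReal
    (relativeGain G κ η d r θ / (1 + relativeGain G κ η d r θ)))]
  swap
  · have hm := measurable_relativeGain hG.measurable κ η d
    exact (hm.div (hm.const_add 1)).ennreal_ofReal
  have hinner : ∀ θ, ∫⁻ r in Ioi 0, ENNReal.ofReal r * ENNReal.ofReal
      (relativeGain G κ η d r θ / (1 + relativeGain G κ η d r θ)) = ENNReal.ofReal (J θ) := by
    intro θ
    -- The gain vanishes below `d`, so the integral over `(0, ∞)` is one over `[d, ∞)`.
    rw [hJ, ← lintegral_Ici_interference (hκG θ) hd hη,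
      ← inter_eq_self_of_subset_left (Ici_subset_Ioi.2 hd),
      ← setLIntegral_indicator measurableSet_Ici]
    refine lintegral_congr fun r => ?_
    by_cases hr : r ∈ Ici d
    · simp [relativeGain, hr]
    · simp [relativeGain, hr]
  simp_rw [hinner]
  -- Periodicity moves the angular range from `(-π, π)` to `(0, 2π)`.
  have hper := hJp.intervalIntegral_add_eq 0 (-Real.pi)
  rw [zero_add, show -Real.pi + 2 * Real.pi = Real.pi by ring] at hper
  rw [hper, intervalIntegral.integral_of_le (by linarith [Real.pi_pos]),
    integral_Ioc_eq_integral_Ioo, ofReal_integral_eq_lintegral_ofReal]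
  · exact hJc.integrableOn_Icc.mono_set Ioo_subset_Icc_self
  · exact Eventually.of_forall hJ0

/-- The success probability for a continuous, nonnegative and periodic antenna gain. -/
theorem successProb_eq_exp {G : ℝ → ℝ} (hG : Continuous G) (hG0 : ∀ θ, 0 ≤ G θ)
    (hGp : Function.Periodic G (2 * Real.pi)) {P η R g₀ Ξ : ℝ} (σ : ℝ) (hP : 0 < P) (hη : 2 < η)
    (hR : 0 < R) (hg₀ : 0 < g₀) (hΞ : 0 < Ξ) (hlam : 0 ≤ lam) {v₀ : ℂ} (hv₀ : v₀ ≠ 0)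
    (hM : PPPModel μ lam X h₀ h) :
    successProb μ G P η R σ g₀ Ξ v₀ X h₀ h =
      Real.exp (-(Ξ * ‖v₀‖ ^ η * σ ^ 2 / (g₀ * P)) -
        lam * ∫ θ in (0 : ℝ)..(2 * Real.pi),
          Ξ * ‖v₀‖ ^ η / g₀ * G θ * (√3 * R / 2) ^ (2 - η) / (η - 2) *
            gauss2F1 1 (1 - 2 / η) (2 - 2 / η)
              (-(Ξ * ‖v₀‖ ^ η / g₀ * G θ) / (√3 * R / 2) ^ η)) := by
  have hn : 0 < ‖v₀‖ := norm_pos_iff.2 hv₀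
  have hnη : 0 < ‖v₀‖ ^ η := Real.rpow_pos_of_pos hn _
  set κ := Ξ * ‖v₀‖ ^ η / g₀ with hκ
  set d := √3 * R / 2 with hd
  have hκ0 : 0 < κ := by positivity
  have hd0 : 0 < d := by positivity
  set c : ℂ → ℝ := fun v => relativeGain G κ η d ‖v‖ (Complex.arg (v / v₀)) with hcdef
  have hc0 : ∀ v, 0 ≤ c v := fun v => relativeGain_nonneg hG0 hκ0.le hd0.le _ _
  have hcm : Measurable c := by
    have hm : Measurable fun v : ℂ => (‖v‖, Complex.arg (v / v₀)) :=
      measurable_norm.prodMk (Complex.measurable_arg.comp (measurable_id.div_const _))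
    exact (measurable_relativeGain hG.measurable κ η d).comp hm
  -- Received power per unit fading on the intended link. As `Ξ = (κ / P) q`, the factor `q` cancels
  -- from the event.
  set q := P * g₀ * ‖v₀‖ ^ (-η) with hq
  have hq0 : 0 < q := by positivity
  have hκq : Ξ = κ / P * q := by
    rw [hκ, hq, Real.rpow_neg hn.le]
    field_simp
  have hevent : {ω | ENNReal.ofReal Ξ < sinr P η R σ ‖v₀‖ (1 * g₀) (fun _ => 1)
      (fun v => G (Complex.arg (v / v₀))) X h₀ h ω} =
      {ω | ENNReal.ofReal (κ / P * σ ^ 2) +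
        ∑' i, ENNReal.ofReal (c (X i ω)) * ENNReal.ofReal (h i ω) < ENNReal.ofReal (h₀ ω)} := by
    ext ω
    have hterm : ∀ i, ENNReal.ofReal (κ / P) * {v : ℂ | d ≤ ‖v‖}.indicator (fun v =>
        ENNReal.ofReal (P * h i ω * 1 * G (Complex.arg (v / v₀)) * ‖v‖ ^ (-η))) (X i ω) =
        ENNReal.ofReal (c (X i ω)) * ENNReal.ofReal (h i ω) := by
      intro i
      by_cases hi : d ≤ ‖X i ω‖
      · rw [indicator_of_mem (show X i ω ∈ {v : ℂ | d ≤ ‖v‖} from hi),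
          ← ENNReal.ofReal_mul (by positivity), ← ENNReal.ofReal_mul (hc0 _)]
        simp only [hcdef, relativeGain]
        rw [indicator_of_mem (show ‖X i ω‖ ∈ Ici d from hi)]
        congr 1
        field_simp
      · rw [indicator_of_notMem (show X i ω ∉ {v : ℂ | d ≤ ‖v‖} from hi)]
        simp only [hcdef, relativeGain]
        rw [indicator_of_notMem (show ‖X i ω‖ ∉ Ici d from hi)]
        simp
    have hΞ0 : ENNReal.ofReal Ξ ≠ 0 := (ENNReal.ofReal_pos.2 hΞ).ne'
    have hnum : ENNReal.ofReal (P * h₀ ω * (1 * g₀) * ‖v₀‖ ^ (-η)) =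
        ENNReal.ofReal q * ENNReal.ofReal (h₀ ω) := by
      rw [← ENNReal.ofReal_mul hq0.le]
      congr 1
      ring
    simp only [mem_ofPred_eq]
    -- Since `Ξ` is positive and finite, the denominator can be cleared even where it is `0` or `∞`.
    rw [sinr, ENNReal.lt_div_iff_mul_lt (.inr ENNReal.ofReal_ne_top) (.inr hΞ0), hnum, hκq,
      mul_comm (κ / P),
      ENNReal.ofReal_mul hq0.le, mul_assoc, ENNReal.mul_lt_mul_iff_right
        (ENNReal.ofReal_pos.2 hq0).ne' ENNReal.ofReal_ne_top, mul_add,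
      ENNReal.ofReal_mul (by positivity : 0 ≤ κ / P), interference, ← ENNReal.tsum_mul_left]
    simp_rw [← hd, hterm]
  obtain ⟨hint, hint0⟩ := lintegral_relativeGain hG hG0 hGp hκ0.le hη hd0 hv₀
  rw [successProb, hevent, measureReal_def, hM.measure_add_tsum_lt _ hcm hc0, hint,
    ← ENNReal.ofReal_mul hlam, expNeg_ofReal (by positivity),
    expNeg_ofReal (mul_nonneg hlam hint0), ← ENNReal.ofReal_mul (Real.exp_nonneg _),
    ENNReal.toReal_ofReal (by positivity), ← Real.exp_add, sub_eq_add_neg]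
  congr 3
  rw [hκ]
  field_simp

end SuccessProbability

/-! ### Antenna gain and threshold -/

theorem continuous_antennaGain (b : ℝ) (n : ℕ) : Continuous (antennaGain b n) := by
  unfold antennaGain
  fun_prop

theorem antennaGain_nonneg {b : ℝ} (hb0 : 0 ≤ b) (hb1 : b ≤ 1) (n : ℕ) (θ : ℝ) :
    0 ≤ antennaGain b n θ := by
  unfold antennaGain
  nlinarith [Real.neg_one_le_cos (n * θ)]

theorem periodic_antennaGain (b : ℝ) (n : ℕ) :
    Function.Periodic (antennaGain b n) (2 * Real.pi) := fun θ => by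
  simp only [antennaGain]
  rw [mul_add, Real.cos_add_nat_mul_two_pi]

theorem antennaGain_zero (b : ℝ) (n : ℕ) : antennaGain b n 0 = 1 + b := by
  simp [antennaGain]

theorem sinrThreshold_pos {L ζ W Ts : ℝ} {m : ℕ} (hL : 0 < L) (hζ : 0 < ζ) (hW : 0 < W)
    (hTs : 0 < Ts) (hm : 0 < m) : 0 < sinrThreshold L ζ W Ts m := by
  have : (0 : ℝ) < m := by exact_mod_cast hm
  exact sub_pos.2 (Real.one_lt_rpow one_lt_two (by positivity))

end IoTNetwork

/-! ### Specialisation to the cosine antenna pattern. -/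

theorem corollary3 {Ω : Type*} [MeasurableSpace Ω] (μ : Measure Ω) [IsProbabilityMeasure μ]
    -- geometry of the network, path loss, transmission power, noise
    (Δx Δy R η P σ : ℝ) (NG : ℕ)
    (hΔx : 0 < Δx) (hΔy : 0 < Δy) (hR : 0 < R) (hNG : 0 < NG) (hη : 2 < η) (hP : 0 < P)
    -- antenna pattern
    (b : ℝ) (n : ℕ) (hb0 : 0 ≤ b) (hb1 : b ≤ 1)
    -- packet size, rate parameters, number of segments
    (L ζ W Ts : ℝ) (m : ℕ) (hL : 0 < L) (hζ0 : 0 < ζ) (hζ1 : ζ ≤ 1) (hW : 0 < W) (hTs : 0 < Ts)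
    (hm : 0 < m)
    -- location of the intended device
    (v₀ : ℂ) (hv₀ : v₀ ≠ 0)
    -- locations of the devices and fading gains
    (X : ℕ → Ω → ℂ) (h₀ : Ω → ℝ) (h : ℕ → Ω → ℝ)
    (hmodel : PPPModel μ (activeDensity Δx Δy NG) X h₀ h) :
    -- receive gain of the intended link equal to 2
    successProb μ (antennaGain b n) P η R σ 2 (sinrThreshold L ζ W Ts m) v₀ X h₀ h =
      Real.exp
        (-(sinrThreshold L ζ W Ts m * ‖v₀‖ ^ η * σ ^ 2 / (2 * P)) -
          ∫ θ in (0 : ℝ)..(2 * Real.pi),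
            sinrThreshold L ζ W Ts m * ‖v₀‖ ^ η * antennaGain b n θ * (√3 * R / 2) ^ (2 - η) /
                (2 * Δx * Δy * NG * (η - 2)) *
              gauss2F1 1 (1 - 2 / η) (2 - 2 / η)
                (-(sinrThreshold L ζ W Ts m * ‖v₀‖ ^ η * antennaGain b n θ) /
                  (2 * (√3 * R / 2) ^ η))) ∧
    -- receive gain of the intended link equal to `G(0) = 1 + b` (which is 2 for `b = 1`)
    successProb μ (antennaGain b n) P η R σ (antennaGain b n 0) (sinrThreshold L ζ W Ts m)
        v₀ X h₀ h =
      Real.exp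
        (-(sinrThreshold L ζ W Ts m * ‖v₀‖ ^ η * σ ^ 2 / ((1 + b) * P)) -
          ∫ θ in (0 : ℝ)..(2 * Real.pi),
            sinrThreshold L ζ W Ts m * ‖v₀‖ ^ η * antennaGain b n θ * (√3 * R / 2) ^ (2 - η) /
                ((1 + b) * Δx * Δy * NG * (η - 2)) *
              gauss2F1 1 (1 - 2 / η) (2 - 2 / η)
                (-(sinrThreshold L ζ W Ts m * ‖v₀‖ ^ η * antennaGain b n θ) /
                  ((1 + b) * (√3 * R / 2) ^ η))) := by
  have hlam : 0 ≤ activeDensity Δx Δy NG := by unfold activeDensity; positivity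
  have hNG' : (NG : ℝ) ≠ 0 := by exact_mod_cast hNG.ne'
  have hη2 : η - 2 ≠ 0 := by linarith
  have hd : (√3 * R / 2) ^ η ≠ 0 := (Real.rpow_pos_of_pos (by positivity) _).ne'
  -- The gain of the intended link enters only as a positive number, so one formula in `g₀` yields
  -- both claims.
  have key : ∀ g₀ : ℝ, 0 < g₀ →
      successProb μ (antennaGain b n) P η R σ g₀ (sinrThreshold L ζ W Ts m) v₀ X h₀ h =
      Real.exp
        (-(sinrThreshold L ζ W Ts m * ‖v₀‖ ^ η * σ ^ 2 / (g₀ * P)) -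
          ∫ θ in (0 : ℝ)..(2 * Real.pi),
            sinrThreshold L ζ W Ts m * ‖v₀‖ ^ η * antennaGain b n θ * (√3 * R / 2) ^ (2 - η) /
                (g₀ * Δx * Δy * NG * (η - 2)) *
              gauss2F1 1 (1 - 2 / η) (2 - 2 / η)
                (-(sinrThreshold L ζ W Ts m * ‖v₀‖ ^ η * antennaGain b n θ) /
                  (g₀ * (√3 * R / 2) ^ η))) := by
    intro g₀ hg₀
    rw [successProb_eq_exp (continuous_antennaGain b n) (antennaGain_nonneg hb0 hb1 n)
      (periodic_antennaGain b n) σ hP hη hR hg₀ (sinrThreshold_pos hL hζ0 hW hTs hm) hlam hv₀ hmodel,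
      ← intervalIntegral.integral_const_mul]
    congr 2
    refine intervalIntegral.integral_congr fun θ _ => ?_
    rw [← mul_assoc]
    congr 1
    · unfold activeDensity
      field_simp
    · congr 1
      field_simp
  refine ⟨key 2 two_pos, ?_⟩
  rw [antennaGain_zero]
  exact key (1 + b) (by linarith)
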